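/- **Setting.** A finite Markov decision process (MDP) $\mathcal M=((V,E),(V_1,V_R),\mathbb P,w)$ consists of a finite directed graph $(V,E)$ in which every vertex has at least one out-neighbour, a partition of $V$ into vertices $V_1$ of the player and probabilistic vertices $V_R$, for each $v\in V_R$ a probability distribution $\mathbb P(v)$ whose support is exactly the set of out-neighbours of $v$, and payoffs $w\colon E\to\mathbb Q$. A play is an infinite path $\pi=v_0v_1v_2\cdots$. A (deterministic, history-dependent) strategy $\sigma$ maps each finite prefix ending in a vertex $v\in V_1$ to an out-neighbour of $v$; an outcome of $\sigma$ from $v$ is a play from $v$ consistent with $\sigma$; and $\Pr^{\sigma}_{\mathcal M,v}$ is the induced distribution over plays. For $T\subseteq V$, $k\ge 0$, $\ell\ge 1$, $\alpha\in\mathbb Q$ define the sets of plays - $\mathrm{Reach}(T)$: some $v_i\in T$; $\mathrm{Reach}_{\le k}(T)$: some $v_i\in T$ with $i\le k$; $\mathrm{Safe}(T)$: all $v_i\in T$; $\mathrm{B\ddot uchi}(T)$: $v_i\in T$ for infinitely many $i$; - $\mathrm{DirFWMP}(\ell,\alpha)$: for every $i\ge 0$ there is $j\in\{1,\dots,\ell\}$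 with $\frac1j\sum_{k=0}^{j-1}w(v_{i+k},v_{i+k+1})\ge\alpha$. A strategy $\sigma$ is winning from $v$ for sure-$O$ if all outcomes of $\sigma$ from $v$ belong to $O$, for positive-$O$ if $\Pr^{\sigma}_{\mathcal M,v}(O)>0$, and for almost-sure-$O$ if $\Pr^{\sigma}_{\mathcal M,v}(O)=1$. The winning region for a condition, or for a combination such as sure-$O$-almost-sure-$O'$, is the set of vertices from which a single strategy is winning for (all parts of) it. If $S\subseteq V$ is such that every vertex of $S$ has an out-neighbour in $S$ and every probabilistic vertex of $S$ has all its out-neighbours in $S$, then $\mathcal M\restriction S$ denotes the subMDP obtained by restricting $\mathcal M$ to $S$. **Algorithm** $\mathsf A(\mathcal M,\ell,\alpha,T)$. Let $W$ be the winning region for sure-$\mathrm{DirFWMP}(\ell,\alpha)$-positive-$\mathrm{Reach}(T)$ in $\mathcal M$. If $W=V$, return $V$. Otherwise let $S$ be the winning region for sure-$\mathrm{Safe}(W)$ in $\mathcal M$ (it induces a subMDP and is a proper subset of $V$), and return $\mathsf A(\mathcal M\restriction S,\ell,\alpha,T\cap S)$. **Theorem.** Let $\mathcal M$ be a finite MDP,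 $\ell\ge1$ an integer, $\alpha\in\mathbb Q$ and $T\subseteq V$. 1. $\mathsf A(\mathcal M,\ell,\alpha,T)$ is exactly the winning region for sure-$\mathrm{DirFWMP}(\ell,\alpha)$-almost-sure-$\mathrm{B\ddot uchi}(T)$ in $\mathcal M$. 2. Every vertex that is winning for sure-$\mathrm{DirFWMP}(\ell,\alpha)$-positive-$\mathrm{Reach}(T)$ in $\mathcal M$ is also winning for sure-$\mathrm{DirFWMP}(\ell,\alpha)$-positive-$\mathrm{Reach}_{\le |V|\cdot\ell}(T)$ in $\mathcal M$. -/

import Mathlib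

/-- A (finite, once `V` is finite) Markov decision process on the vertex set `V`. The vertices in
`main` belong to the player, those in `mainᶜ` are probabilistic; a probabilistic vertex carries a
probability distribution whose support is its set of out-neighbours. Only the payoffs of edges
matter. The vertex set may be empty. -/
structure MDP (V : Type*) where
  edge : V → V → Prop
  exists_edge : ∀ v, ∃ u, edge v u
  main : Set V
  prob : (mainᶜ : Set V) → PMF V
  support_prob : ∀ (v : (mainᶜ : Set V)) (u : V), u ∈ (prob v).support ↔ edge v u
  payoff : V → V → ℚ

namespace MDP

variable {V : Type*}

/-! ### Plays, strategies, outcomes -/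

/-- The plays: infinite paths. -/
def plays (M : MDP V) : Set (ℕ → V) :=
  {π | ∀ i, M.edge (π i) (π (i + 1))}

/-- The prefix `v₀ v₁ … v_j` of a play. -/
def playPrefix (π : ℕ → V) (j : ℕ) : List V :=
  (List.range (j + 1)).map π

/-- The suffix `v_i v_{i+1} …` of a play. -/
def playSuffix (π : ℕ → V) (i : ℕ) : ℕ → V :=
  fun k => π (i + k)

/-- A deterministic strategy: it maps a prefix that ends in a vertex of the player to an
out-neighbour of that vertex. It is a total function on finite sequences of vertices; its values
on sequences that are not prefixes ending in a vertex of the player are never used. -/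
structure Strategy (M : MDP V) where
  move : List V → V
  edge_move : ∀ (ρ : List V) (v : V), v ∈ M.main → M.edge v (move (ρ ++ [v]))

/-- `π` is an outcome of `σ` from `v`. -/
def IsOutcome (M : MDP V) (σ : M.Strategy) (v : V) (π : ℕ → V) : Prop :=
  π ∈ M.plays ∧ π 0 = v ∧ ∀ j, π j ∈ M.main → π (j + 1) = σ.move (playPrefix π j)

/-! ### The distribution over plays -/

open Classical in
/-- The law of the next vertex after the finite sequence `ρ`, whose last vertex is `x`. -/
noncomputable def nextDist (M : MDP V) (σ : M.Strategy) (ρ : List V) (x : V) : PMF V :=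
  if h : x ∈ M.main then PMF.pure (σ.move ρ) else M.prob ⟨x, h⟩

/-- The finite sequence `h 0, …, h n` as a list. -/
def historyList (n : ℕ) (h : Finset.Iic n → V) : List V :=
  List.ofFn fun i : Fin (n + 1) => h ⟨i, Finset.mem_Iic.2 (Nat.lt_succ_iff.1 i.isLt)⟩

/-- The transition kernel from histories `v₀ … v_n` to the next vertex. -/
noncomputable def stepKernel [Finite V] [MeasurableSpace V] [DiscreteMeasurableSpace V]
    (M : MDP V) (σ : M.Strategy) (n : ℕ) :
    ProbabilityTheory.Kernel (Finset.Iic n → V) V :=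
  ProbabilityTheory.Kernel.ofFunOfCountable fun h =>
    (M.nextDist σ (historyList n h) (h ⟨n, Finset.mem_Iic.2 le_rfl⟩)).toMeasure

instance [Finite V] [MeasurableSpace V] [DiscreteMeasurableSpace V]
    (M : MDP V) (σ : M.Strategy) (n : ℕ) :
    ProbabilityTheory.IsMarkovKernel (M.stepKernel σ n) :=
  ⟨fun h => PMF.toMeasure.isProbabilityMeasure
    (M.nextDist σ (historyList n h) (h ⟨n, Finset.mem_Iic.2 le_rfl⟩))⟩

/-- The distribution over plays given by the strategy `σ` and the initial vertex `v`. -/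
noncomputable def playMeasure [Finite V] [MeasurableSpace V] [DiscreteMeasurableSpace V]
    (M : MDP V) (σ : M.Strategy) (v : V) : MeasureTheory.Measure (ℕ → V) :=
  ProbabilityTheory.Kernel.traj (X := fun _ => V) (M.stepKernel σ) 0 fun _ => v

/-! ### Objectives -/

/-- Reachability. -/
def reach (M : MDP V) (T : Set V) : Set (ℕ → V) :=
  {π | π ∈ M.plays ∧ ∃ i, π i ∈ T}

/-- Bounded reachability: `T` is visited within the first `k` steps. -/
def reachWithin (M : MDP V) (k : ℕ) (T : Set V) : Set (ℕ → V) :=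
  {π | π ∈ M.plays ∧ ∃ i, i ≤ k ∧ π i ∈ T}

/-- Safety. -/
def safe (M : MDP V) (T : Set V) : Set (ℕ → V) :=
  {π | π ∈ M.plays ∧ ∀ i, π i ∈ T}

/-- Büchi: `T` is visited infinitely often. -/
def buchi (M : MDP V) (T : Set V) : Set (ℕ → V) :=
  {π | π ∈ M.plays ∧ ∀ i, ∃ j, i ≤ j ∧ π j ∈ T}

/-- Good window: the `α`-window starting at position `0` closes in at most `ℓ` steps. -/
def goodWindow (M : MDP V) (ℓ : ℕ) (α : ℚ) : Set (ℕ → V) :=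
  {π | π ∈ M.plays ∧ ∃ j : ℕ, 1 ≤ j ∧ j ≤ ℓ ∧
    α ≤ 1 / (j : ℚ) * ∑ k ∈ Finset.range j, M.payoff (π k) (π (k + 1))}

/-- Direct fixed window mean-payoff: every `α`-window closes in at most `ℓ` steps. -/
def dirFWMP (M : MDP V) (ℓ : ℕ) (α : ℚ) : Set (ℕ → V) :=
  {π | π ∈ M.plays ∧ ∀ i, playSuffix π i ∈ M.goodWindow ℓ α}

/-! ### Winning conditions and winning regions -/

/-- `σ` is winning for sure-`O` from `v`. -/
def SureWinning (M : MDP V) (σ : M.Strategy) (v : V) (O : Set (ℕ → V)) : Prop :=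
  ∀ π, M.IsOutcome σ v π → π ∈ O

/-- `σ` is winning for positive-`O` from `v`. -/
def PositiveWinning [Finite V] [MeasurableSpace V] [DiscreteMeasurableSpace V]
    (M : MDP V) (σ : M.Strategy) (v : V) (O : Set (ℕ → V)) : Prop :=
  0 < M.playMeasure σ v O

/-- `σ` is winning for almost-sure-`O` from `v`. -/
def AlmostSureWinning [Finite V] [MeasurableSpace V] [DiscreteMeasurableSpace V]
    (M : MDP V) (σ : M.Strategy) (v : V) (O : Set (ℕ → V)) : Prop :=
  M.playMeasure σ v O = 1

/-- The winning region for sure-`O`. -/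
def sureRegion (M : MDP V) (O : Set (ℕ → V)) : Set V :=
  {v | ∃ σ : M.Strategy, M.SureWinning σ v O}

/-- The winning region for sure-`O`-positive-`O'`: one strategy achieves both. -/
def surePositiveRegion [Finite V] [MeasurableSpace V] [DiscreteMeasurableSpace V]
    (M : MDP V) (O O' : Set (ℕ → V)) : Set V :=
  {v | ∃ σ : M.Strategy, M.SureWinning σ v O ∧ M.PositiveWinning σ v O'}

/-- The winning region for sure-`O`-almost-sure-`O'`: one strategy achieves both. -/
def sureAlmostSureRegion [Finite V] [MeasurableSpace V] [DiscreteMeasurableSpace V]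
    (M : MDP V) (O O' : Set (ℕ → V)) : Set V :=
  {v | ∃ σ : M.Strategy, M.SureWinning σ v O ∧ M.AlmostSureWinning σ v O'}

/-! ### SubMDPs -/

/-- `S` induces a subMDP. -/
def InducesSubMDP (M : MDP V) (S : Set V) : Prop :=
  (∀ v ∈ S, ∃ u ∈ S, M.edge v u) ∧ ∀ v ∈ S, v ∉ M.main → ∀ u, M.edge v u → u ∈ S

/-- The restriction to `S` of a distribution that is supported in `S`. -/
noncomputable def restrictPMF (p : PMF V) (S : Set V) (h : p.support ⊆ S) : PMF S :=
  ⟨fun u => p u, by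
    have h1 : ∑' u : S, p u = 1 := by
      rw [tsum_subtype S (fun u => p u), Set.indicator_eq_self.2 h]
      exact p.tsum_coe
    exact h1 ▸ ENNReal.summable.hasSum⟩

/-- The subMDP induced by `S`. -/
noncomputable def subMDP (M : MDP V) (S : Set V) (h : M.InducesSubMDP S) : MDP S where
  edge v u := M.edge v u
  exists_edge v := by
    obtain ⟨u, hu, e⟩ := h.1 v v.2
    exact ⟨⟨u, hu⟩, e⟩
  main := {v | (v : V) ∈ M.main}
  prob v := restrictPMF (M.prob ⟨v.1.1, v.2⟩) S fun u hu =>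
    h.2 v.1.1 v.1.2 v.2 u ((M.support_prob _ u).1 hu)
  support_prob v u := M.support_prob ⟨v.1.1, v.2⟩ u
  payoff v u := M.payoff v u

/-! ### Two facts about the sure-safety region, needed for the recursion -/

/-- Every strategy has an outcome from every vertex. -/
theorem exists_isOutcome (M : MDP V) (σ : M.Strategy) (v : V) : ∃ π, M.IsOutcome σ v π := by
  classical
  choose nxt hnxt using M.exists_edge
  let g : V × List V → V × List V := fun p =>
    let u := if p.1 ∈ M.main then σ.move (p.2 ++ [p.1]) else nxt p.1
    (u, p.2 ++ [p.1])
  let s : ℕ → V × List V := fun n => g^[n] (v, [])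
  have hs : ∀ n, s (n + 1) = g (s n) := fun n => Function.iterate_succ_apply' g n _
  have hpre : ∀ n, (s n).2 = (List.range n).map fun k => (s k).1 := by
    intro n
    induction n with
    | zero => rfl
    | succ n ih => rw [hs, List.range_succ, List.map_append, ← ih]; rfl
  have hlast : ∀ n, (s n).2 ++ [(s n).1] = playPrefix (fun k => (s k).1) n := by
    intro n
    rw [hpre, playPrefix, List.range_succ, List.map_append]; rfl
  have hfst : ∀ n, (s (n + 1)).1 =
      if (s n).1 ∈ M.main then σ.move ((s n).2 ++ [(s n).1]) else nxt (s n).1 := by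
    intro n; rw [hs]
  refine ⟨fun k => (s k).1, fun i => ?_, rfl, fun j hj => ?_⟩
  · change M.edge (s i).1 (s (i + 1)).1
    rw [hfst]
    split_ifs with h
    · exact σ.edge_move _ _ h
    · exact hnxt _
  · change (s (j + 1)).1 = _
    rw [hfst, if_pos hj, hlast]

theorem sureRegion_safe_subset (M : MDP V) (W : Set V) : M.sureRegion (M.safe W) ⊆ W := by
  rintro v ⟨σ, hσ⟩
  obtain ⟨π, hπ⟩ := M.exists_isOutcome σ v
  have := (hσ π hπ).2 0
  rwa [hπ.2.1] at this

/-- The winning region for a sure safety objective induces a subMDP. -/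
theorem inducesSubMDP_sureRegion_safe (M : MDP V) (W : Set V) :
    M.InducesSubMDP (M.sureRegion (M.safe W)) := by
  classical
  have key : ∀ (v u : V) (σ : M.Strategy), M.SureWinning σ v (M.safe W) → M.edge v u →
      (v ∈ M.main → u = σ.move [v]) → u ∈ M.sureRegion (M.safe W) := by
    intro v u σ hσ he hu
    let τ : M.Strategy := ⟨fun ρ => σ.move (v :: ρ), fun ρ x hx => σ.edge_move (v :: ρ) x hx⟩
    refine ⟨τ, fun π hπ => ?_⟩
    let π' : ℕ → V := fun n => Nat.casesOn n v π
    have hpp : ∀ j, playPrefix π' (j + 1) = v :: playPrefix π j := by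
      intro j
      simp only [playPrefix]
      rw [List.range_succ_eq_map, List.map_cons, List.map_map]
      rfl
    have hout : M.IsOutcome σ v π' := by
      refine ⟨fun i => ?_, rfl, fun j hj => ?_⟩
      · cases i with
        | zero => change M.edge v (π 0); rw [hπ.2.1]; exact he
        | succ i => exact hπ.1 i
      · cases j with
        | zero => change π 0 = σ.move [v]; rw [hπ.2.1]; exact hu hj
        | succ j => rw [hpp]; exact hπ.2.2 j hj
    exact ⟨hπ.1, fun i => (hσ π' hout).2 (i + 1)⟩
  constructor
  · rintro v ⟨σ, hσ⟩
    by_cases hv : v ∈ M.main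
    · exact ⟨_, key v _ σ hσ (σ.edge_move [] v hv) fun _ => rfl, σ.edge_move [] v hv⟩
    · obtain ⟨u, hu⟩ := M.exists_edge v
      exact ⟨u, key v u σ hσ hu fun h => absurd h hv, hu⟩
  · rintro v ⟨σ, hσ⟩ hv u hu
    exact key v u σ hσ hu fun h => absurd h hv

/-! ### The algorithm -/

open Classical in
/-- The recursive algorithm: compute the winning region `W` for
sure-`DirFWMP(ℓ, α)`-positive-`Reach(T)`; if it consists of all vertices, return all vertices;
otherwise compute the winning region `S` for sure-`Safe(W)` and return the result of the recursive
call on the subMDP induced by `S`, with target `T ∩ S`. -/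
noncomputable def sureDirFWMPASBuchiAlgo {V : Type*} [Finite V] [MeasurableSpace V]
    [DiscreteMeasurableSpace V] (M : MDP V) (ℓ : ℕ) (α : ℚ) (T : Set V) : Set V :=
  let W : Set V := M.surePositiveRegion (M.dirFWMP ℓ α) (M.reach T)
  if _hW : W = Set.univ then Set.univ
  else
    let S : Set V := M.sureRegion (M.safe W)
    Subtype.val '' sureDirFWMPASBuchiAlgo
      (M.subMDP S (M.inducesSubMDP_sureRegion_safe W)) ℓ α {v : S | (v : V) ∈ T}
termination_by Nat.card V
decreasing_by
  obtain ⟨x, hx⟩ := (Set.ne_univ_iff_exists_notMem _).1 _hW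
  exact Finite.card_subtype_lt fun h => hx (M.sureRegion_safe_subset W h)

end MDP

open MeasureTheory ProbabilityTheory Set
open scoped ENNReal

namespace MDP

variable {V : Type*}

/-! Probability is reduced to combinatorics of outcomes. A finite history has positive probability
exactly when each of its steps is an edge that respects the strategy (`playMeasure_cyl_pos_iff`).
Hence positive reachability means that some outcome visits `T`.

Bounded reachability: take a visit to `T` that is earliest over all surely winning strategies and
their outcomes. Along that outcome, positions at which all earlier windows are closed occur with
gaps at most `ℓ`. If the visit came after more than `|V| * ℓ` steps, two of `|V| + 1` such positions
would carry the same vertex. Cutting out the loop between them spoils no window and gives an earlier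
visit (`exists_lt_of_closedAt`).

Almost-sure Büchi is squeezed between two measure-free conditions: `T` stays reachable after every
history (necessary, as every history has positive probability), and `T` stays reachable within a
uniform number of steps (sufficient, as transition probabilities are bounded below). Induction on
the number of vertices gives `recurrentRegion` ⊆ algorithm ⊆ `boundedRecurrentRegion`, so all three
equal the almost-sure region. If `W` is everything, strategies witnessing `W` are played in rounds,
each ending once its windows are closed. Otherwise a strategy keeping `T` reachable never leaves
`W`, so it lives in the subMDP on `S`; conversely, strategies of the subMDP lift. Since both
conditions speak only of outcomes, no measure has to be compared between an MDP and its subMDP. -/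

/-! ### Steps consistent with a strategy -/

/-- The step from `π j` to `π (j + 1)` is an edge that follows `σ`. -/
def StepOK (M : MDP V) (σ : M.Strategy) (π : ℕ → V) (j : ℕ) : Prop :=
  M.edge (π j) (π (j + 1)) ∧ (π j ∈ M.main → π (j + 1) = σ.move (playPrefix π j))

theorem isOutcome_iff {M : MDP V} {σ : M.Strategy} {v : V} {π : ℕ → V} :
    M.IsOutcome σ v π ↔ π 0 = v ∧ ∀ j, M.StepOK σ π j :=
  ⟨fun h => ⟨h.2.1, fun j => ⟨h.1 j, h.2.2 j⟩⟩,
    fun h => ⟨fun j => (h.2 j).1, h.1, fun j => (h.2 j).2⟩⟩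

theorem IsOutcome.stepOK {M : MDP V} {σ : M.Strategy} {v : V} {π : ℕ → V}
    (h : M.IsOutcome σ v π) (j : ℕ) : M.StepOK σ π j :=
  (isOutcome_iff.1 h).2 j

theorem playPrefix_congr {π π' : ℕ → V} {n : ℕ} (h : ∀ i ≤ n, π i = π' i) :
    playPrefix π n = playPrefix π' n :=
  List.map_congr_left fun i hi => h i (Nat.lt_succ_iff.1 (List.mem_range.1 hi))

theorem StepOK.congr {M : MDP V} {σ : M.Strategy} {π π' : ℕ → V} {j : ℕ}
    (h : M.StepOK σ π j) (he : ∀ i ≤ j + 1, π' i = π i) : M.StepOK σ π' j := by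
  unfold StepOK
  rw [he j (by omega), he (j + 1) le_rfl, playPrefix_congr fun i hi => he i (by omega)]
  exact h

/-! ### Cylinders -/

/-- The sequences that agree with `π` up to time `n`. -/
def cyl (π : ℕ → V) (n : ℕ) : Set (ℕ → V) :=
  {π' | ∀ i ≤ n, π' i = π i}

theorem cyl_eq_preimage (π : ℕ → V) (n : ℕ) :
    cyl π n = Preorder.frestrictLe (π := fun _ => V) n ⁻¹' {Preorder.frestrictLe n π} := by
  ext π'
  simp only [cyl, mem_ofPred_eq, mem_preimage, mem_singleton_iff, funext_iff, Subtype.forall,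
    Finset.mem_Iic, Preorder.frestrictLe_apply]

theorem historyList_frestrictLe (π : ℕ → V) (n : ℕ) :
    historyList n (Preorder.frestrictLe (π := fun _ => V) n π) = playPrefix π n := by
  apply List.ext_getElem <;> simp [historyList, playPrefix, -List.ofFn_succ]

theorem nextDist_ne_zero_iff (M : MDP V) (σ : M.Strategy) (π : ℕ → V) (n : ℕ) :
    M.nextDist σ (playPrefix π n) (π n) (π (n + 1)) ≠ 0 ↔ M.StepOK σ π n := by
  unfold nextDist StepOK
  split_ifs with h
  · rw [← PMF.mem_support_iff, PMF.support_pure, mem_singleton_iff]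
    refine ⟨fun he => ⟨?_, fun _ => he⟩, fun he => he.2 h⟩
    rw [he, playPrefix, List.range_succ, List.map_append]
    exact σ.edge_move _ _ h
  · rw [← PMF.mem_support_iff, M.support_prob]
    exact ⟨fun he => ⟨he, fun hh => absurd hh h⟩, fun he => he.1⟩

/-- The transition probabilities of a finite MDP are bounded away from zero. -/
theorem exists_le_nextDist {V : Type*} [Finite V] (M : MDP V) : ∃ p : ℝ≥0∞, p ≠ 0 ∧ ∀ (σ : M.Strategy) (π : ℕ → V)
    (n : ℕ), M.StepOK σ π n → p ≤ M.nextDist σ (playPrefix π n) (π n) (π (n + 1)) := by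
  classical
  let f : (M.mainᶜ : Set V) × V → ℝ≥0∞ := fun x => if M.prob x.1 x.2 = 0 then 1 else M.prob x.1 x.2
  obtain ⟨p, hp0, hp⟩ : ∃ p : ℝ≥0∞, p ≠ 0 ∧ ∀ x, p ≤ f x := by
    cases isEmpty_or_nonempty ((M.mainᶜ : Set V) × V)
    · exact ⟨1, one_ne_zero, fun x => isEmptyElim x⟩
    · obtain ⟨x, hx⟩ := Finite.exists_min f
      refine ⟨f x, ?_, hx⟩
      dsimp only [f]
      split_ifs with h
      exacts [one_ne_zero, h]
  -- The bound `1` serves the player's vertices, where the prescribed move has probability one.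
  refine ⟨min p 1, ?_, fun σ π n h => ?_⟩
  · exact (lt_min (pos_iff_ne_zero.2 hp0) zero_lt_one).ne'
  · have hne := (nextDist_ne_zero_iff M σ π n).2 h
    unfold nextDist at hne ⊢
    split_ifs at hne ⊢ with hm
    · rw [h.2 hm, PMF.pure_apply, if_pos rfl]
      exact min_le_right _ _
    · have := hp (⟨π n, hm⟩, π (n + 1))
      rw [show f (⟨π n, hm⟩, π (n + 1)) = _ from if_neg hne] at this
      exact (min_le_left _ _).trans this

/-! ### Probabilities of cylinders and almost-sure recurrence -/

section Measure

variable [Finite V] [MeasurableSpace V] [DiscreteMeasurableSpace V]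

instance (M : MDP V) (σ : M.Strategy) (v : V) : IsProbabilityMeasure (M.playMeasure σ v) := by
  unfold playMeasure; infer_instance

theorem measurableSet_cyl (π : ℕ → V) (n : ℕ) : MeasurableSet (cyl π n) := by
  rw [cyl_eq_preimage]
  exact (Preorder.measurable_frestrictLe (X := fun _ => V) n) (measurableSet_singleton _)

theorem playMeasure_cyl_zero (M : MDP V) (σ : M.Strategy) (π : ℕ → V) :
    M.playMeasure σ (π 0) (cyl π 0) = 1 := by
  rw [cyl_eq_preimage, ← Measure.map_apply (Preorder.measurable_frestrictLe _)
    (measurableSet_singleton _), playMeasure, Kernel.traj_map_frestrictLe_apply,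
    Kernel.partialTraj_self, Kernel.id_apply, Measure.dirac_apply' _ (measurableSet_singleton _)]
  refine indicator_of_mem ?_ _
  funext i
  obtain ⟨i, hi⟩ := i
  obtain rfl : i = 0 := by simpa using hi
  rfl

theorem playMeasure_cyl_of_ne (M : MDP V) (σ : M.Strategy) {v : V} {π : ℕ → V} (h : π 0 ≠ v) :
    M.playMeasure σ v (cyl π 0) = 0 := by
  rw [cyl_eq_preimage, ← Measure.map_apply (Preorder.measurable_frestrictLe _)
    (measurableSet_singleton _), playMeasure, Kernel.traj_map_frestrictLe_apply,
    Kernel.partialTraj_self, Kernel.id_apply, Measure.dirac_apply' _ (measurableSet_singleton _)]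
  refine indicator_of_notMem (fun hh => h ?_) _
  exact (congrFun hh ⟨0, Finset.mem_Iic.2 le_rfl⟩).symm

/-- Chain rule: the joint law of the history up to `n` and the next vertex is the
composition-product of the history's law with the step kernel. -/
theorem playMeasure_cyl_succ (M : MDP V) (σ : M.Strategy) (v : V) (π : ℕ → V) (n : ℕ) :
    M.playMeasure σ v (cyl π (n + 1)) =
      M.nextDist σ (playPrefix π n) (π n) (π (n + 1)) * M.playMeasure σ v (cyl π n) := by
  set x₀ : Finset.Iic 0 → V := fun _ => v
  have hset : cyl π (n + 1) = (fun x : ℕ → V => (Preorder.frestrictLe (π := fun _ => V) n x,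
      x (n + 1))) ⁻¹' ({Preorder.frestrictLe n π} ×ˢ {π (n + 1)}) := by
    ext π'
    rw [mk_preimage_prod, ← cyl_eq_preimage]
    constructor
    · exact fun h => ⟨fun i hi => h i (by omega), h _ le_rfl⟩
    · rintro ⟨h, h'⟩ i hi
      obtain hi | rfl := Nat.le_succ_iff.1 hi
      · exact h i hi
      · exact h'
  have hmeas : Measurable (fun x : ℕ → V => (Preorder.frestrictLe (π := fun _ => V) n x,
      x (n + 1))) := (Preorder.measurable_frestrictLe n).prodMk (measurable_pi_apply _)
  have hs : MeasurableSet ({Preorder.frestrictLe (π := fun _ => V) n π} :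
    Set (Finset.Iic n → V)) := measurableSet_singleton _
  rw [hset, ← Measure.map_apply hmeas (hs.prod (measurableSet_singleton _)), playMeasure,
    ← Kernel.partialTraj_compProd_eq_map_traj (X := fun _ => V) (Nat.zero_le n),
    Measure.compProd_apply_prod hs (measurableSet_singleton _), lintegral_singleton,
    cyl_eq_preimage, ← Measure.map_apply (Preorder.measurable_frestrictLe _) hs,
    Kernel.traj_map_frestrictLe_apply]
  congr 1
  change (M.nextDist σ (historyList n (Preorder.frestrictLe (π := fun _ => V) n π))
    (π n)).toMeasure {π (n + 1)} = _
  rw [historyList_frestrictLe, PMF.toMeasure_apply_singleton _ _ (measurableSet_singleton _)]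

theorem playMeasure_cyl_pos_iff (M : MDP V) (σ : M.Strategy) (v : V) (π : ℕ → V) (n : ℕ) :
    M.playMeasure σ v (cyl π n) ≠ 0 ↔ π 0 = v ∧ ∀ j < n, M.StepOK σ π j := by
  induction n with
  | zero =>
    by_cases h : π 0 = v
    · subst h; simp [playMeasure_cyl_zero]
    · simp [playMeasure_cyl_of_ne M σ h, h]
  | succ n ih =>
    rw [playMeasure_cyl_succ, mul_ne_zero_iff, nextDist_ne_zero_iff, ih]
    constructor
    · rintro ⟨h1, h2, h3⟩
      refine ⟨h2, fun j hj => ?_⟩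
      obtain hj | rfl := Nat.lt_succ_iff_lt_or_eq.1 hj
      exacts [h3 j hj, h1]
    · rintro ⟨h1, h2⟩
      exact ⟨h2 n (by omega), h1, fun j hj => h2 j (by omega)⟩

/-- A bound relative to each cylinder of length `n` holds relative to each union of them. -/
theorem measure_inter_le_of_cyl (μ : Measure (ℕ → V)) (n : ℕ) {H E : Set (ℕ → V)} {c : ℝ≥0∞}
    (hE : ∀ π ∈ E, cyl π n ⊆ E) (hH : ∀ π, μ (cyl π n ∩ H) ≤ c * μ (cyl π n)) :
    μ (E ∩ H) ≤ c * μ E := by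
  classical
  have := Fintype.ofFinite (Finset.Iic n → V)
  have hf : ∀ a : Finset.Iic n → V,
      MeasurableSet (Preorder.frestrictLe (π := fun _ => V) n ⁻¹' {a}) := fun a =>
    (Preorder.measurable_frestrictLe (X := fun _ => V) n) (measurableSet_singleton a)
  have hsum : ∀ X : Set (ℕ → V),
      μ X = ∑ a, μ (Preorder.frestrictLe (π := fun _ => V) n ⁻¹' {a} ∩ X) := by
    intro X
    have h := sum_measure_preimage_singleton (μ := μ.restrict X) Finset.univ fun a _ => hf a
    rw [Finset.coe_univ, preimage_univ, Measure.restrict_apply_univ] at h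
    rw [← h]
    exact Finset.sum_congr rfl fun a _ => Measure.restrict_apply (hf a)
  rw [hsum (E ∩ H), hsum E, Finset.mul_sum]
  refine Finset.sum_le_sum fun a _ => ?_
  obtain ⟨π, rfl⟩ : ∃ π : ℕ → V, Preorder.frestrictLe n π = a := by
    refine ⟨fun i => if h : i ≤ n then a ⟨i, Finset.mem_Iic.2 h⟩ else
      a ⟨0, Finset.mem_Iic.2 n.zero_le⟩, ?_⟩
    funext i
    exact dif_pos (Finset.mem_Iic.1 i.2)
  rw [← cyl_eq_preimage]
  by_cases hπ : π ∈ E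
  · rw [← inter_assoc, inter_eq_left.2 (hE π hπ)]
    exact hH π
  · have : cyl π n ∩ (E ∩ H) = ∅ := by
      refine eq_empty_of_forall_notMem fun π' h => hπ ?_
      exact hE π' h.2.1 fun i hi => (h.1 i hi).symm
    rw [this, measure_empty]
    exact zero_le

theorem ae_isOutcome (M : MDP V) (σ : M.Strategy) (v : V) :
    ∀ᵐ π ∂M.playMeasure σ v, M.IsOutcome σ v π := by
  have h : ∀ n, M.playMeasure σ v {π | ¬(π 0 = v ∧ ∀ j < n, M.StepOK σ π j)} = 0 := by
    intro n
    have := measure_inter_le_of_cyl (M.playMeasure σ v) n (E := univ) (c := 0)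
      -- With `c = 0` it suffices to look at each cylinder: it is disjoint from the bad set if its
      -- history is consistent, and null otherwise.
      (H := {π | ¬(π 0 = v ∧ ∀ j < n, M.StepOK σ π j)}) (fun _ _ => subset_univ _) fun π => by
        rw [zero_mul, nonpos_iff_eq_zero]
        by_cases hπ : π 0 = v ∧ ∀ j < n, M.StepOK σ π j
        · refine measure_mono_null (fun π' h' => h'.2 ?_) measure_empty
          exact ⟨(h'.1 0 n.zero_le).trans hπ.1, fun j hj =>
            (hπ.2 j hj).congr fun i hi => h'.1 i (by omega)⟩
        · refine measure_mono_null inter_subset_left ?_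
          by_contra hne
          exact hπ ((playMeasure_cyl_pos_iff M σ v π n).1 hne)
    rwa [univ_inter, zero_mul, nonpos_iff_eq_zero] at this
  have h' : ∀ᵐ π ∂M.playMeasure σ v, ∀ n, π 0 = v ∧ ∀ j < n, M.StepOK σ π j :=
    ae_all_iff.2 h
  filter_upwards [h'] with π hπ
  exact isOutcome_iff.2 ⟨(hπ 0).1, fun j => (hπ (j + 1)).2 j (by omega)⟩

theorem exists_isOutcome_mem {M : MDP V} {σ : M.Strategy} {v : V} {O : Set (ℕ → V)}
    (h : M.playMeasure σ v O ≠ 0) : ∃ π ∈ O, M.IsOutcome σ v π := by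
  by_contra! hcon
  exact h (measure_mono_null hcon (ae_isOutcome M σ v))

theorem exists_isOutcome_mem_cyl {M : MDP V} {σ : M.Strategy} {v : V} {O : Set (ℕ → V)}
    (h : M.AlmostSureWinning σ v O) {π : ℕ → V} (hπ : M.IsOutcome σ v π) (n : ℕ) :
    ∃ π' ∈ O, M.IsOutcome σ v π' ∧ π' ∈ cyl π n := by
  have hpos : M.playMeasure σ v (cyl π n) ≠ 0 :=
    (playMeasure_cyl_pos_iff M σ v π n).2 ⟨hπ.2.1, fun j _ => hπ.stepOK j⟩
  have : M.playMeasure σ v (O ∩ cyl π n) ≠ 0 := by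
    intro h0
    -- Splitting along the measurable cylinder avoids any measurability of `O`.
    have h1 := measure_inter_add_sdiff (μ := M.playMeasure σ v) O (measurableSet_cyl π n)
    rw [h0, zero_add, h] at h1
    have h2 : M.playMeasure σ v (cyl π n)ᶜ = 1 :=
      le_antisymm prob_le_one (h1 ▸ measure_mono fun x hx => hx.2)
    exact hpos ((prob_compl_eq_one_iff (measurableSet_cyl π n)).1 h2)
  obtain ⟨π', h1, h2⟩ := exists_isOutcome_mem this
  exact ⟨π', h1.1, h2, h1.2⟩

theorem positiveWinning_of_cyl {M : MDP V} {σ : M.Strategy} {v : V} {O : Set (ℕ → V)}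
    {π : ℕ → V} (hπ : M.IsOutcome σ v π) (n : ℕ)
    (h : ∀ π' ∈ cyl π n, M.IsOutcome σ v π' → π' ∈ O) : M.PositiveWinning σ v O := by
  refine pos_iff_ne_zero.2 fun h0 => ?_
  refine (playMeasure_cyl_pos_iff M σ v π n).2 ⟨hπ.2.1, fun j _ => hπ.stepOK j⟩ ?_
  refine measure_mono_null (t := O ∪ {π' | ¬M.IsOutcome σ v π'}) (fun π' h' => ?_)
    (measure_union_null h0 (ae_isOutcome M σ v))
  by_cases ho : M.IsOutcome σ v π'
  · exact Or.inl (h π' h' ho)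
  · exact Or.inr ho

theorem pow_mul_playMeasure_cyl_le {M : MDP V} {p : ℝ≥0∞} (hp : ∀ (σ : M.Strategy) (π : ℕ → V)
    (n : ℕ), M.StepOK σ π n → p ≤ M.nextDist σ (playPrefix π n) (π n) (π (n + 1)))
    {σ : M.Strategy} {v : V} {π : ℕ → V} (hπ : M.IsOutcome σ v π) (n k : ℕ) :
    p ^ k * M.playMeasure σ v (cyl π n) ≤ M.playMeasure σ v (cyl π (n + k)) := by
  induction k with
  | zero => simp
  | succ k ih =>
    rw [← add_assoc, playMeasure_cyl_succ, pow_succ', mul_assoc]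
    exact mul_le_mul' (hp σ π _ (hπ.stepOK _)) ih

/-- If from every history the target can be reached within `N` further steps, then it is almost
surely visited infinitely often. -/
theorem almostSureWinning_buchi {M : MDP V} {σ : M.Strategy} {v : V} {T : Set V} (N : ℕ)
    (h : ∀ π, M.IsOutcome σ v π → ∀ n, ∃ π', M.IsOutcome σ v π' ∧ π' ∈ cyl π n ∧
      ∃ k ≤ N, π' (n + k) ∈ T) :
    M.AlmostSureWinning σ v (M.buchi T) := by
  set μ := M.playMeasure σ v with hμ
  obtain ⟨p, hp0, hp⟩ := exists_le_nextDist M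
  let H : ℕ → Set (ℕ → V) := fun n => {π | ∀ k ≤ N, π (n + k) ∉ T}
  have hstep : ∀ n π, μ (cyl π n ∩ H n) ≤ (1 - p ^ N) * μ (cyl π n) := by
    intro n π
    by_cases hne : μ (cyl π n) = 0
    · rw [measure_mono_null inter_subset_left hne]
      exact zero_le
    obtain ⟨π₁, h₁, ho⟩ := exists_isOutcome_mem hne
    have hcyl : cyl π₁ n = cyl π n := by
      ext x
      exact ⟨fun hx i hi => (hx i hi).trans (h₁ i hi),
        fun hx i hi => (hx i hi).trans (h₁ i hi).symm⟩
    obtain ⟨π₂, ho₂, h₂, k, hk, hT⟩ := h π₁ ho n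
    have hcyl₂ : cyl π₂ n = cyl π n := by
      rw [← hcyl]
      ext x
      exact ⟨fun hx i hi => (hx i hi).trans (h₂ i hi),
        fun hx i hi => (hx i hi).trans (h₂ i hi).symm⟩
    rw [← hcyl₂]
    -- The cylinder of `π₂` up to time `n + N` avoids `H n` and carries at least the fraction `p ^
    -- N` of the cylinder up to time `n`.
    have hle := pow_mul_playMeasure_cyl_le hp ho₂ n N
    rw [← hμ] at hle
    rw [ENNReal.sub_mul fun _ _ => measure_ne_top _ _, one_mul]
    refine ENNReal.le_sub_of_add_le_right (ne_top_of_le_ne_top (measure_ne_top _ _) hle) ?_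
    refine (add_le_add_right hle _).trans ?_
    rw [← measure_union _ (measurableSet_cyl _ _)]
    · refine measure_mono (union_subset inter_subset_left fun x hx i hi => hx i (by omega))
    · refine disjoint_left.2 fun x hx hx' => hx.2 k hk ?_
      rwa [hx' (n + k) (by omega)]
  have hlt : 1 - p ^ N < 1 :=
    ENNReal.sub_lt_self ENNReal.one_ne_top one_ne_zero (pow_ne_zero _ hp0)
  have hnull : ∀ n, μ {π | ∀ j, n ≤ j → π j ∉ T} = 0 := by
    intro n
    -- Blocks have `N + 1` positions, since `k ≤ N` includes `k = 0`; each missed block costs a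
    -- factor `1 - p ^ N`.
    have hpow : ∀ m, μ {π | ∀ j, n ≤ j → j < n + m * (N + 1) → π j ∉ T} ≤ (1 - p ^ N) ^ m := by
      intro m
      induction m with
      | zero => simpa using prob_le_one
      | succ m ih =>
        have hE : ∀ π ∈ {π : ℕ → V | ∀ j, n ≤ j → j < n + m * (N + 1) → π j ∉ T},
            cyl π (n + m * (N + 1)) ⊆ {π | ∀ j, n ≤ j → j < n + m * (N + 1) → π j ∉ T} := by
          intro π hπ x hx j h1 h2
          rw [hx j h2.le]
          exact hπ j h1 h2
        refine le_trans (measure_mono ?_)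
          ((measure_inter_le_of_cyl μ (n + m * (N + 1)) hE (hstep _)).trans ?_)
        · refine fun π hπ => ⟨fun j h1 h2 => ?_, fun k hk => ?_⟩
          · exact hπ j h1 (by linarith)
          · exact hπ _ (by omega) (by linarith)
        · rw [pow_succ']
          exact mul_le_mul' le_rfl ih
    refine le_antisymm (ge_of_tendsto' (ENNReal.tendsto_pow_atTop_nhds_zero_of_lt_one hlt)
      fun m => (measure_mono ?_).trans (hpow m)) zero_le
    exact fun π hπ j hj _ => hπ j hj
  have hae : ∀ᵐ π ∂μ, π ∈ M.buchi T := by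
    have h2 : ∀ᵐ π ∂μ, ∀ n, ¬∀ j, n ≤ j → π j ∉ T :=
      ae_all_iff.2 fun n => by simpa [ae_iff] using hnull n
    filter_upwards [h2, ae_isOutcome M σ v] with π h3 h4
    refine ⟨h4.1, fun n => ?_⟩
    have := h3 n
    push Not at this
    exact this
  unfold AlmostSureWinning
  have huniv : M.buchi T =ᵐ[μ] univ := Filter.eventuallyEq_univ.2 hae
  rw [← hμ, measure_congr huniv, measure_univ]

end Measure

/-! ### Histories and residual strategies -/

/-- The history `v₀ … v_{n-1}`. -/
def hist (π : ℕ → V) (n : ℕ) : List V :=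
  (List.range n).map π

/-- The sequence that follows `π` for `n` steps and then continues as `π'`. -/
def glue (n : ℕ) (π π' : ℕ → V) : ℕ → V :=
  fun k => if k < n then π k else π' (k - n)

theorem glue_of_lt {n k : ℕ} (π π' : ℕ → V) (h : k < n) : glue n π π' k = π k :=
  if_pos h

theorem glue_add (n : ℕ) (π π' : ℕ → V) (k : ℕ) : glue n π π' (n + k) = π' k := by
  simp [glue]

theorem playSuffix_glue (n : ℕ) (π π' : ℕ → V) : playSuffix (glue n π π') n = π' :=
  funext fun k => glue_add n π π' k

theorem glue_mem_cyl {n : ℕ} {π π' : ℕ → V} (h : π' 0 = π n) : glue n π π' ∈ cyl π n := by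
  intro i hi
  obtain hi | rfl := hi.lt_or_eq
  · exact glue_of_lt _ _ hi
  · rw [← h]
    exact glue_add i π π' 0

theorem hist_congr {π π' : ℕ → V} {n : ℕ} (h : ∀ i < n, π i = π' i) : hist π n = hist π' n :=
  List.map_congr_left fun i hi => h i (List.mem_range.1 hi)

theorem hist_glue (n : ℕ) (π π' : ℕ → V) : hist (glue n π π') n = hist π n :=
  hist_congr fun _ hi => glue_of_lt _ _ hi

theorem length_playPrefix (π : ℕ → V) (n : ℕ) : (playPrefix π n).length = n + 1 := by
  simp [playPrefix]

theorem length_hist (π : ℕ → V) (n : ℕ) : (hist π n).length = n := by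
  simp [hist]

theorem playPrefix_add (π : ℕ → V) (n k : ℕ) :
    playPrefix π (n + k) = hist π n ++ playPrefix (playSuffix π n) k := by
  rw [playPrefix, add_assoc, List.range_add, List.map_append, List.map_map]
  rfl

theorem playPrefix_drop (π : ℕ → V) (n k : ℕ) :
    (playPrefix π (n + k)).drop n = playPrefix (playSuffix π n) k := by
  rw [playPrefix_add, List.drop_left' (length_hist π n)]

theorem playPrefix_take (π : ℕ → V) {n m : ℕ} (h : n ≤ m) :
    (playPrefix π m).take (n + 1) = playPrefix π n := by
  rw [playPrefix, ← List.map_take, List.take_range, min_eq_left (by omega)]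
  rfl

theorem mem_cyl_of_playPrefix_eq {π π' : ℕ → V} {n : ℕ} (h : playPrefix π n = playPrefix π' n) :
    π ∈ cyl π' n := by
  intro i hi
  exact List.map_inj_left.1 h i (List.mem_range.2 (by omega))

/-- The strategy `σ` after the history `h`. -/
def residual {M : MDP V} (σ : M.Strategy) (h : List V) : M.Strategy :=
  ⟨fun ρ => σ.move (h ++ ρ), fun ρ v hv => by
    rw [← List.append_assoc]
    exact σ.edge_move _ v hv⟩

theorem stepOK_residual {M : MDP V} {σ : M.Strategy} {π : ℕ → V} {n k : ℕ} :
    M.StepOK (residual σ (hist π n)) (playSuffix π n) k ↔ M.StepOK σ π (n + k) := by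
  unfold StepOK
  rw [playPrefix_add]
  rfl

theorem stepOK_glue_add {M : MDP V} {σ : M.Strategy} {π π' : ℕ → V} {n k : ℕ} :
    M.StepOK σ (glue n π π') (n + k) ↔ M.StepOK (residual σ (hist π n)) π' k := by
  rw [← stepOK_residual, playSuffix_glue, hist_glue]

theorem stepOK_glue_of_lt {M : MDP V} {σ : M.Strategy} {π π' : ℕ → V} {n j : ℕ}
    (h : π' 0 = π n) (hj : j < n) (hs : M.StepOK σ π j) : M.StepOK σ (glue n π π') j :=
  hs.congr fun i hi => glue_mem_cyl h i (by omega)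

theorem isOutcome_glue {M : MDP V} {σ : M.Strategy} {v : V} {π π' : ℕ → V} {n : ℕ}
    (hv : π 0 = v) (hπ : ∀ j < n, M.StepOK σ π j)
    (hπ' : M.IsOutcome (residual σ (hist π n)) (π n) π') : M.IsOutcome σ v (glue n π π') := by
  refine isOutcome_iff.2 ⟨(glue_mem_cyl hπ'.2.1 0 n.zero_le).trans hv, fun j => ?_⟩
  obtain hj | hj := lt_or_ge j n
  · exact stepOK_glue_of_lt hπ'.2.1 hj (hπ j hj)
  · obtain ⟨k, rfl⟩ := Nat.exists_eq_add_of_le hj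
    exact stepOK_glue_add.2 (hπ'.stepOK k)

theorem IsOutcome.playSuffix {M : MDP V} {σ : M.Strategy} {v : V} {π : ℕ → V}
    (h : M.IsOutcome σ v π) (n : ℕ) :
    M.IsOutcome (residual σ (hist π n)) (π n) (playSuffix π n) :=
  isOutcome_iff.2 ⟨rfl, fun k => stepOK_residual.2 (h.stepOK (n + k))⟩

theorem exists_isOutcome_mem_cyl_of_stepOK {M : MDP V} {σ : M.Strategy} {π : ℕ → V} {n : ℕ}
    (h : ∀ j < n, M.StepOK σ π j) : ∃ π' ∈ cyl π n, M.IsOutcome σ (π 0) π' := by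
  obtain ⟨π', h'⟩ := M.exists_isOutcome (residual σ (hist π n)) (π n)
  exact ⟨_, glue_mem_cyl h'.2.1, isOutcome_glue rfl h h'⟩

/-! ### Windows -/

/-- The total excess over `α` of the `j` payoffs from position `i` on. -/
def excess (M : MDP V) (α : ℚ) (π : ℕ → V) (i j : ℕ) : ℚ :=
  ∑ k ∈ Finset.range j, (M.payoff (π (i + k)) (π (i + k + 1)) - α)

theorem excess_add (M : MDP V) (α : ℚ) (π : ℕ → V) (i a b : ℕ) :
    M.excess α π i (a + b) = M.excess α π i a + M.excess α π (i + a) b := by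
  simp only [excess, Finset.sum_range_add, add_assoc]

theorem excess_playSuffix (M : MDP V) (α : ℚ) (π : ℕ → V) (n i j : ℕ) :
    M.excess α (playSuffix π n) i j = M.excess α π (n + i) j := by
  simp only [excess, playSuffix, add_assoc]

theorem excess_congr (M : MDP V) (α : ℚ) {π π' : ℕ → V} {i j : ℕ}
    (h : ∀ k ≤ i + j, π k = π' k) : M.excess α π i j = M.excess α π' i j := by
  refine Finset.sum_congr rfl fun k hk => ?_
  have := Finset.mem_range.1 hk
  rw [h (i + k) (by omega), h (i + k + 1) (by omega)]

/-- Multiplying the mean by `j` turns the window condition into the sign of a sum that is additive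
under concatenation. -/
theorem mem_dirFWMP_iff {M : MDP V} {ℓ : ℕ} {α : ℚ} {π : ℕ → V} :
    π ∈ M.dirFWMP ℓ α ↔ π ∈ M.plays ∧ ∀ i, ∃ j, 1 ≤ j ∧ j ≤ ℓ ∧ 0 ≤ M.excess α π i j := by
  have key : ∀ i j : ℕ, 1 ≤ j → (0 ≤ M.excess α π i j ↔ α ≤ 1 / (j : ℚ) *
      ∑ k ∈ Finset.range j, M.payoff (playSuffix π i k) (playSuffix π i (k + 1))) := by
    intro i j hj
    have hj' : (0 : ℚ) < j := by exact_mod_cast hj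
    rw [one_div, le_inv_mul_iff₀ hj', excess, Finset.sum_sub_distrib, Finset.sum_const,
      Finset.card_range, nsmul_eq_mul, sub_nonneg]
    rfl
  constructor
  · rintro ⟨h1, h2⟩
    refine ⟨h1, fun i => ?_⟩
    obtain ⟨-, j, hj, hl, h⟩ := h2 i
    exact ⟨j, hj, hl, (key i j hj).2 h⟩
  · rintro ⟨h1, h2⟩
    refine ⟨h1, fun i => ⟨fun k => h1 (i + k), ?_⟩⟩
    obtain ⟨j, hj, hl, h⟩ := h2 i
    exact ⟨j, hj, hl, (key i j hj).1 h⟩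

theorem playSuffix_mem_dirFWMP {M : MDP V} {ℓ : ℕ} {α : ℚ} {π : ℕ → V}
    (h : π ∈ M.dirFWMP ℓ α) (n : ℕ) : playSuffix π n ∈ M.dirFWMP ℓ α := by
  rw [mem_dirFWMP_iff] at h ⊢
  refine ⟨fun i => h.1 (n + i), fun i => ?_⟩
  simp only [excess_playSuffix]
  exact h.2 (n + i)

/-- All windows opened before position `p` close by position `p`. -/
def ClosedAt (M : MDP V) (ℓ : ℕ) (α : ℚ) (π : ℕ → V) (p : ℕ) : Prop :=
  ∀ i < p, ∃ j, 1 ≤ j ∧ j ≤ ℓ ∧ i + j ≤ p ∧ 0 ≤ M.excess α π i j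

theorem ClosedAt.congr {M : MDP V} {ℓ : ℕ} {α : ℚ} {π π' : ℕ → V} {p : ℕ}
    (h : M.ClosedAt ℓ α π p) (he : ∀ k ≤ p, π k = π' k) : M.ClosedAt ℓ α π' p := by
  intro i hi
  obtain ⟨j, h1, h2, h3, h4⟩ := h i hi
  refine ⟨j, h1, h2, h3, ?_⟩
  rwa [← M.excess_congr α fun k hk => he k (hk.trans h3)]

/-- Take the first position at which the window opened at `p` closes. Every proper nonempty initial
segment of this window has negative excess, so every final segment has positive excess, and the
windows opened inside close there too. -/
theorem ClosedAt.exists_next {M : MDP V} {ℓ : ℕ} {α : ℚ} {π : ℕ → V} {p : ℕ}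
    (h : M.ClosedAt ℓ α π p) (hπ : π ∈ M.dirFWMP ℓ α) :
    ∃ q, p < q ∧ q ≤ p + ℓ ∧ M.ClosedAt ℓ α π q := by
  classical
  have hex : ∃ j, 1 ≤ j ∧ 0 ≤ M.excess α π p j := by
    obtain ⟨j, h1, -, h2⟩ := (mem_dirFWMP_iff.1 hπ).2 p
    exact ⟨j, h1, h2⟩
  obtain ⟨h1, h2⟩ := Nat.find_spec hex
  have hmin : ∀ a, 1 ≤ a → a < Nat.find hex → M.excess α π p a < 0 := fun a ha hlt =>
    not_le.1 fun hle => Nat.find_min hex hlt ⟨ha, hle⟩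
  have hl : Nat.find hex ≤ ℓ := by
    obtain ⟨j, h1, h2, h3⟩ := (mem_dirFWMP_iff.1 hπ).2 p
    exact (Nat.find_min' hex ⟨h1, h3⟩).trans h2
  generalize Nat.find hex = j at *
  refine ⟨p + j, by omega, by omega, fun i hi => ?_⟩
  obtain hip | hip := lt_or_ge i p
  · obtain ⟨k, k1, k2, k3, k4⟩ := h i hip
    exact ⟨k, k1, k2, by omega, k4⟩
  obtain ⟨a, rfl⟩ := Nat.exists_eq_add_of_le hip
  obtain rfl | ha := Nat.eq_zero_or_pos a
  · exact ⟨j, h1, hl, le_rfl, h2⟩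
  · obtain ⟨b, rfl⟩ := Nat.exists_eq_add_of_le (show a ≤ j by omega)
    refine ⟨b, by omega, by omega, by omega, ?_⟩
    have := hmin a ha (by omega)
    rw [excess_add] at h2
    linarith

theorem exists_closedAt {M : MDP V} {ℓ : ℕ} {α : ℚ} {π : ℕ → V}
    (hπ : π ∈ M.dirFWMP ℓ α) (K : ℕ) : ∃ q, K ≤ q ∧ q ≤ K + ℓ ∧ M.ClosedAt ℓ α π q := by
  induction K with
  | zero => exact ⟨0, le_rfl, Nat.zero_le _, fun i hi => absurd hi i.not_lt_zero⟩
  | succ K ih =>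
    obtain ⟨q, h1, h2, h3⟩ := ih
    obtain h | rfl := Nat.lt_or_eq_of_le h1
    · exact ⟨q, h, by omega, h3⟩
    · obtain ⟨q, h4, h5, h6⟩ := h3.exists_next hπ
      exact ⟨q, h4, by omega, h6⟩

theorem ClosedAt.mem_dirFWMP {M : MDP V} {ℓ : ℕ} {α : ℚ} {π : ℕ → V} {p : ℕ}
    (h : M.ClosedAt ℓ α π p) (hπ : π ∈ M.plays) (hs : playSuffix π p ∈ M.dirFWMP ℓ α) :
    π ∈ M.dirFWMP ℓ α := by
  refine mem_dirFWMP_iff.2 ⟨hπ, fun i => ?_⟩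
  obtain hi | hi := lt_or_ge i p
  · obtain ⟨j, h1, h2, -, h3⟩ := h i hi
    exact ⟨j, h1, h2, h3⟩
  · obtain ⟨k, rfl⟩ := Nat.exists_eq_add_of_le hi
    simpa only [excess_playSuffix] using (mem_dirFWMP_iff.1 hs).2 k

theorem SureWinning.residual {M : MDP V} {ℓ : ℕ} {α : ℚ} {σ : M.Strategy} {v : V}
    (h : M.SureWinning σ v (M.dirFWMP ℓ α)) {π : ℕ → V} (hπ : M.IsOutcome σ v π) (n : ℕ) :
    M.SureWinning (residual σ (hist π n)) (π n) (M.dirFWMP ℓ α) := by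
  intro π' hπ'
  have := playSuffix_mem_dirFWMP (h _ (isOutcome_glue hπ.2.1 (fun j _ => hπ.stepOK j) hπ')) n
  rwa [playSuffix_glue] at this

/-! ### Switching to another strategy after a given history -/

open Classical in
/-- The strategy that follows `σ`, unless the history begins with `π 0, …, π i`, from which point
on it follows `τ`. -/
noncomputable def switch {M : MDP V} (σ : M.Strategy) (π : ℕ → V) (i : ℕ) (τ : M.Strategy) :
    M.Strategy where
  move ρ := if ρ.take (i + 1) = playPrefix π i then τ.move (ρ.drop i) else σ.move ρ
  edge_move ρ v hv := by
    split_ifs with h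
    · have hl := congrArg List.length h
      rw [length_playPrefix, List.length_take, List.length_append, List.length_singleton] at hl
      rw [List.drop_append_of_le_length (by omega)]
      exact τ.edge_move _ v hv
    · exact σ.edge_move ρ v hv

theorem switch_move_of_mem {M : MDP V} {σ τ : M.Strategy} {π π' : ℕ → V} {i : ℕ}
    (h : π' ∈ cyl π i) (k : ℕ) :
    (switch σ π i τ).move (playPrefix π' (i + k)) = τ.move (playPrefix (playSuffix π' i) k) := by
  rw [← playPrefix_drop]
  exact if_pos (by rw [playPrefix_take π' (Nat.le_add_right i k), playPrefix_congr h])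

theorem switch_move_of_lt {M : MDP V} {σ τ : M.Strategy} {π π' : ℕ → V} {i j : ℕ} (h : j < i) :
    (switch σ π i τ).move (playPrefix π' j) = σ.move (playPrefix π' j) := by
  refine if_neg fun he => ?_
  have := congrArg List.length he
  rw [length_playPrefix, List.length_take, length_playPrefix] at this
  omega

theorem switch_move_of_notMem {M : MDP V} {σ τ : M.Strategy} {π π' : ℕ → V} {i : ℕ}
    (h : π' ∉ cyl π i) (j : ℕ) :
    (switch σ π i τ).move (playPrefix π' j) = σ.move (playPrefix π' j) := by
  obtain hj | hj := lt_or_ge j i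
  · exact switch_move_of_lt hj
  · refine if_neg fun he => h (mem_cyl_of_playPrefix_eq ?_)
    rwa [playPrefix_take π' hj] at he

theorem isOutcome_of_switch_of_notMem {M : MDP V} {σ τ : M.Strategy} {v : V} {π π' : ℕ → V}
    {i : ℕ} (h : M.IsOutcome (switch σ π i τ) v π') (hn : π' ∉ cyl π i) : M.IsOutcome σ v π' :=
  ⟨h.1, h.2.1, fun j hj => by rw [h.2.2 j hj, switch_move_of_notMem hn]⟩

theorem isOutcome_of_switch_of_mem {M : MDP V} {σ τ : M.Strategy} {v : V} {π π' : ℕ → V}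
    {i : ℕ} (h : M.IsOutcome (switch σ π i τ) v π') (hn : π' ∈ cyl π i) :
    M.IsOutcome τ (π i) (playSuffix π' i) :=
  ⟨fun k => h.1 (i + k), hn i le_rfl, fun k hk => by
    rw [← switch_move_of_mem hn]
    exact h.2.2 (i + k) hk⟩

theorem isOutcome_switch_glue {M : MDP V} {σ τ : M.Strategy} {v : V} {π π' : ℕ → V}
    {i : ℕ} (h : M.IsOutcome σ v π) (h' : M.IsOutcome τ (π i) π') :
    M.IsOutcome (switch σ π i τ) v (glue i π π') := by
  have hmem : glue i π π' ∈ cyl π i := glue_mem_cyl h'.2.1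
  refine isOutcome_iff.2 ⟨(hmem 0 i.zero_le).trans h.2.1, fun j => ?_⟩
  obtain hj | hj := lt_or_ge j i
  · have := stepOK_glue_of_lt h'.2.1 hj (h.stepOK j)
    exact ⟨this.1, fun hm => by rw [switch_move_of_lt hj]; exact this.2 hm⟩
  · obtain ⟨k, rfl⟩ := Nat.exists_eq_add_of_le hj
    have := h'.stepOK k
    unfold StepOK
    rw [switch_move_of_mem hmem, playSuffix_glue, add_assoc, glue_add, glue_add]
    exact this

/-! ### Sure fixed windows with positive reachability -/

/-- Loop cutting: after the history up to `i`, play as `σ` does after the history up to `j`. No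
window is pending at `i`, so the windows of the new outcomes still close. -/
theorem exists_lt_of_closedAt {M : MDP V} {ℓ : ℕ} {α : ℚ} {T : Set V} {v : V} {σ : M.Strategy}
    (hσ : M.SureWinning σ v (M.dirFWMP ℓ α)) {π : ℕ → V} (hπ : M.IsOutcome σ v π) {t i j : ℕ}
    (ht : π t ∈ T) (hij : i < j) (hjt : j ≤ t) (he : π i = π j) (hi : M.ClosedAt ℓ α π i) :
    ∃ t' < t, ∃ σ' : M.Strategy, M.SureWinning σ' v (M.dirFWMP ℓ α) ∧
      ∃ π', M.IsOutcome σ' v π' ∧ π' t' ∈ T := by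
  have hτ := hσ.residual hπ j
  have hout := hπ.playSuffix j
  rw [← he] at hτ hout
  refine ⟨i + (t - j), by omega, switch σ π i (MDP.residual σ (hist π j)), fun π' hπ' => ?_, _,
    isOutcome_switch_glue hπ hout, ?_⟩
  · by_cases hmem : π' ∈ cyl π i
    · exact (hi.congr fun k hk => (hmem k hk).symm).mem_dirFWMP hπ'.1
        (hτ _ (isOutcome_of_switch_of_mem hπ' hmem))
    · exact hσ _ (isOutcome_of_switch_of_notMem hπ' hmem)
  · rwa [glue_add, playSuffix, Nat.add_sub_cancel' hjt]

section Positive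

variable [Finite V] [MeasurableSpace V] [DiscreteMeasurableSpace V]

theorem mem_surePositiveRegion_reach_iff {M : MDP V} {O : Set (ℕ → V)} {T : Set V} {v : V} :
    v ∈ M.surePositiveRegion O (M.reach T) ↔
      ∃ σ : M.Strategy, M.SureWinning σ v O ∧ ∃ π, M.IsOutcome σ v π ∧ ∃ t, π t ∈ T := by
  constructor
  · rintro ⟨σ, h1, h2⟩
    obtain ⟨π, h3, h4⟩ := exists_isOutcome_mem (ne_of_gt h2)
    exact ⟨σ, h1, π, h4, h3.2⟩
  · rintro ⟨σ, h1, π, h2, t, h3⟩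
    exact ⟨σ, h1, positiveWinning_of_cyl h2 t fun π' h4 h5 => ⟨h5.1, t, by rwa [h4 t le_rfl]⟩⟩

theorem surePositiveRegion_reach_subset_reachWithin (M : MDP V) (ℓ : ℕ) (α : ℚ) (T : Set V) :
    M.surePositiveRegion (M.dirFWMP ℓ α) (M.reach T) ⊆
      M.surePositiveRegion (M.dirFWMP ℓ α) (M.reachWithin (Nat.card V * ℓ) T) := by
  classical
  intro v hv
  have hex : ∃ t, ∃ σ : M.Strategy, M.SureWinning σ v (M.dirFWMP ℓ α) ∧
      ∃ π, M.IsOutcome σ v π ∧ π t ∈ T := by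
    obtain ⟨σ, h1, π, h2, t, h3⟩ := mem_surePositiveRegion_reach_iff.1 hv
    exact ⟨t, σ, h1, π, h2, h3⟩
  obtain ⟨σ, hσ, π, hπ, ht⟩ := Nat.find_spec hex
  have hmin : ∀ t' < Nat.find hex, _ := fun t' h => Nat.find_min hex h
  generalize Nat.find hex = t at *
  have hle : t ≤ Nat.card V * ℓ := by
    by_contra! hlt
    have hnext : ∀ p : {p // M.ClosedAt ℓ α π p}, ∃ q : {p // M.ClosedAt ℓ α π p},
        p.1 < q.1 ∧ q.1 ≤ p.1 + ℓ := by
      rintro ⟨p, hp⟩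
      obtain ⟨q, h1, h2, h3⟩ := hp.exists_next (hσ π hπ)
      exact ⟨⟨q, h3⟩, h1, h2⟩
    choose nxt hnxt₁ hnxt₂ using hnext
    -- Position `0` is vacuously closed; iterating yields closed positions `c k ≤ k * ℓ`, so `c 0,
    -- …, c |V|` all precede the visit at `t`.
    let c : ℕ → {p // M.ClosedAt ℓ α π p} := fun k =>
      nxt^[k] ⟨0, fun i hi => absurd hi i.not_lt_zero⟩
    have hc : ∀ k, c (k + 1) = nxt (c k) := fun k => Function.iterate_succ_apply' nxt k _
    have hmono : StrictMono fun k => (c k).1 := strictMono_nat_of_lt_succ fun k => by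
      rw [hc]
      exact hnxt₁ _
    have hbound : ∀ k, (c k).1 ≤ k * ℓ := by
      intro k
      induction k with
      | zero => exact Nat.zero_le _
      | succ k ih =>
        rw [hc, add_mul, one_mul]
        exact (hnxt₂ _).trans (Nat.add_le_add_right ih _)
    have hninj : ¬Function.Injective fun k : Fin (Nat.card V + 1) => π (c k) := fun h => by
      have := Nat.card_le_card_of_injective _ h
      rw [Nat.card_fin] at this
      omega
    have hcut : ∀ a b : Fin (Nat.card V + 1), a < b → π (c a) ≠ π (c b) := by
      intro a b hab he
      have hb : (c b).1 ≤ t :=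
        (hbound b).trans ((Nat.mul_le_mul_right ℓ (Nat.lt_succ_iff.1 b.2)).trans hlt.le)
      obtain ⟨t', h1, h2⟩ := exists_lt_of_closedAt hσ hπ ht (hmono hab) hb he (c a).2
      exact hmin t' h1 h2
    refine hninj fun a b hab => ?_
    obtain h | h | h := lt_trichotomy a b
    exacts [absurd hab (hcut a b h), h, absurd hab.symm (hcut b a h)]
  exact ⟨σ, hσ, positiveWinning_of_cyl hπ t fun π' h4 h5 =>
    ⟨h5.1, t, hle, by rwa [h4 t le_rfl]⟩⟩

end Positive

/-! ### Playing in rounds -/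

open Classical in
/-- The starting position of the round that position `n` belongs to, where a round lasts until
`K` steps have been made and all windows opened in the round are closed. -/
noncomputable def roundStart (M : MDP V) (ℓ : ℕ) (α : ℚ) (K : ℕ) (π : ℕ → V) : ℕ → ℕ
  | 0 => 0
  | n + 1 =>
    if K ≤ n + 1 - roundStart M ℓ α K π n ∧
        M.ClosedAt ℓ α (playSuffix π (roundStart M ℓ α K π n)) (n + 1 - roundStart M ℓ α K π n)
    then n + 1 else roundStart M ℓ α K π n

section Rounds

variable {M : MDP V} {ℓ : ℕ} {α : ℚ} {K : ℕ}

theorem roundStart_le (π : ℕ → V) (n : ℕ) : M.roundStart ℓ α K π n ≤ n := by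
  induction n with
  | zero => exact le_rfl
  | succ n ih =>
    rw [roundStart]
    split_ifs
    exacts [le_rfl, by omega]

theorem roundStart_congr {π π' : ℕ → V} {n : ℕ} (h : ∀ i ≤ n, π i = π' i) :
    M.roundStart ℓ α K π n = M.roundStart ℓ α K π' n := by
  induction n with
  | zero => rfl
  | succ n ih =>
    have hle := roundStart_le (M := M) (ℓ := ℓ) (α := α) (K := K) π' n
    simp only [roundStart]
    rw [ih fun i hi => h i (by omega)]
    have : M.ClosedAt ℓ α (playSuffix π (M.roundStart ℓ α K π' n))
        (n + 1 - M.roundStart ℓ α K π' n) ↔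
        M.ClosedAt ℓ α (playSuffix π' (M.roundStart ℓ α K π' n))
        (n + 1 - M.roundStart ℓ α K π' n) :=
      ⟨fun hc => hc.congr fun k hk => h _ (by omega),
        fun hc => hc.congr fun k hk => (h _ (by omega)).symm⟩
    classical exact if_congr (and_congr Iff.rfl this) rfl rfl

theorem roundStart_eq_of_le {π : ℕ → V} {m n : ℕ} (h : M.roundStart ℓ α K π n ≤ m) (hmn : m ≤ n) :
    M.roundStart ℓ α K π m = M.roundStart ℓ α K π n := by
  induction n with
  | zero => rw [Nat.le_zero.1 hmn]
  | succ n ih =>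
    obtain rfl | hm := Nat.eq_or_lt_of_le hmn
    · rfl
    · rw [roundStart] at h ⊢
      split_ifs at h ⊢ with hc
      · omega
      · exact ih h (by omega)

/-- The strategy that plays in rounds, following `σ u` in a round that starts at `u`. -/
noncomputable def roundStrategy (ℓ : ℕ) (α : ℚ) (K : ℕ) (v₀ : V) (σ : V → M.Strategy) :
    M.Strategy where
  move ρ :=
    (σ (ρ.getD (M.roundStart ℓ α K (fun i => ρ.getD i v₀) (ρ.length - 1)) v₀)).move
      (ρ.drop (M.roundStart ℓ α K (fun i => ρ.getD i v₀) (ρ.length - 1)))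
  edge_move ρ v hv := by
    have h := roundStart_le (M := M) (ℓ := ℓ) (α := α) (K := K)
      (fun i => (ρ ++ [v]).getD i v₀) ((ρ ++ [v]).length - 1)
    rw [List.length_append, List.length_singleton, Nat.add_sub_cancel] at h ⊢
    rw [List.drop_append_of_le_length h]
    exact (σ _).edge_move _ v hv

variable {v₀ : V} {σ : V → M.Strategy}

theorem roundStrategy_move (π : ℕ → V) {n s k : ℕ} (hs : M.roundStart ℓ α K π n = s)
    (hk : s + k = n) : (roundStrategy ℓ α K v₀ σ).move (playPrefix π n) =
      (σ (π s)).move (playPrefix (playSuffix π s) k) := by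
  have hget : ∀ i ≤ n, (playPrefix π n).getD i v₀ = π i := fun i hi => by
    simp [playPrefix, List.getD, List.getElem?_range (Nat.lt_succ_of_le hi)]
  have hstart : M.roundStart ℓ α K (fun i => (playPrefix π n).getD i v₀)
      ((playPrefix π n).length - 1) = s := by
    rw [length_playPrefix, Nat.add_sub_cancel, roundStart_congr hget, hs]
  simp only [roundStrategy]
  rw [hstart, hget s (by omega), ← hk, playPrefix_drop]

theorem stepOK_roundStrategy {π : ℕ → V} {s k : ℕ} (hs : M.roundStart ℓ α K π (s + k) = s) :
    M.StepOK (roundStrategy ℓ α K v₀ σ) π (s + k) ↔ M.StepOK (σ (π s)) (playSuffix π s) k := by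
  unfold StepOK
  rw [roundStrategy_move π hs rfl]
  rfl

theorem exists_next_roundStart (hK : 1 ≤ K) (hσ : ∀ u, M.SureWinning (σ u) u (M.dirFWMP ℓ α))
    {v : V} {π : ℕ → V} (hπ : M.IsOutcome (roundStrategy ℓ α K v₀ σ) v π) (n : ℕ) :
    ∃ m, n < m ∧ m ≤ n + (K + ℓ) ∧ M.roundStart ℓ α K π m = m ∧
      M.ClosedAt ℓ α (playSuffix π (M.roundStart ℓ α K π n)) (m - M.roundStart ℓ α K π n) := by
  classical
  have hsn := roundStart_le (M := M) (ℓ := ℓ) (α := α) (K := K) π n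
  -- Otherwise the round would follow one surely winning strategy up to `n + K + ℓ`; but that
  -- strategy reaches a closed position between `n + K` and `n + K + ℓ`, which ends the round.
  have hex : ∃ d, d ≤ K + ℓ ∧ M.roundStart ℓ α K π (n + d) ≠ M.roundStart ℓ α K π n := by
    by_contra! hcon
    generalize M.roundStart ℓ α K π n = s at *
    obtain ⟨π', h1, h2⟩ := exists_isOutcome_mem_cyl_of_stepOK (M := M) (σ := σ (π s))
      (π := playSuffix π s) (n := n + (K + ℓ) - s) fun k hk => by
        refine (stepOK_roundStrategy (v₀ := v₀) ?_).1 (hπ.stepOK (s + k))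
        have := hcon (K + ℓ) le_rfl
        rw [roundStart_eq_of_le (n := n + (K + ℓ)) (by omega) (by omega), this]
    obtain ⟨q, hq1, hq2, hq3⟩ := exists_closedAt (hσ _ π' h2) (n + K - s)
    obtain ⟨d, hd⟩ := Nat.exists_eq_add_of_le (show n + 1 ≤ s + q by omega)
    have h3 := hcon d (by omega)
    have h4 := hcon (d + 1) (by omega)
    rw [← add_assoc, roundStart, h3, if_pos] at h4
    · omega
    · have hqd : n + d + 1 - s = q := by omega
      rw [hqd]
      exact ⟨by omega, hq3.congr fun k hk => h1 k (by omega)⟩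
  obtain ⟨hd1, hd2⟩ := Nat.find_spec hex
  have hmin : ∀ d' < Nat.find hex, _ := fun d' h => Nat.find_min hex h
  generalize Nat.find hex = d at *
  obtain _ | d := d
  · exact absurd rfl hd2
  have hd : M.roundStart ℓ α K π (n + d) = M.roundStart ℓ α K π n := by
    by_contra hne
    exact hmin d (by omega) ⟨by omega, hne⟩
  rw [← add_assoc] at hd2
  refine ⟨n + d + 1, by omega, by omega, ?_⟩
  rw [roundStart, hd] at hd2 ⊢
  split_ifs at hd2 ⊢ with hc
  · exact ⟨rfl, hc.2⟩
  · exact absurd rfl hd2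

theorem sureWinning_roundStrategy (hK : 1 ≤ K)
    (hσ : ∀ u, M.SureWinning (σ u) u (M.dirFWMP ℓ α)) (v : V) :
    M.SureWinning (roundStrategy ℓ α K v₀ σ) v (M.dirFWMP ℓ α) := by
  intro π hπ
  refine mem_dirFWMP_iff.2 ⟨hπ.1, fun i => ?_⟩
  have hs := roundStart_le (M := M) (ℓ := ℓ) (α := α) (K := K) π i
  obtain ⟨m, h1, -, -, h2⟩ := exists_next_roundStart hK hσ hπ i
  generalize M.roundStart ℓ α K π i = s at *
  obtain ⟨j, h3, h4, -, h5⟩ := h2 (i - s) (by omega)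
  rw [excess_playSuffix, Nat.add_sub_cancel' hs] at h5
  exact ⟨j, h3, h4, h5⟩

/-- The next round starts within `K + ℓ` steps, and from there an outcome of the fresh strategy
visits `T` within `K` more. The minimal round length `K` keeps the round from being restarted before
that visit. -/
theorem exists_isOutcome_roundStrategy_mem {T : Set V} (hK : 1 ≤ K)
    (hσ : ∀ u, M.SureWinning (σ u) u (M.dirFWMP ℓ α))
    (hT : ∀ u, ∃ π, M.IsOutcome (σ u) u π ∧ ∃ t ≤ K, π t ∈ T)
    {v : V} {π : ℕ → V} (hπ : M.IsOutcome (roundStrategy ℓ α K v₀ σ) v π) (n : ℕ) :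
    ∃ π' ∈ cyl π n, M.IsOutcome (roundStrategy ℓ α K v₀ σ) v π' ∧
      ∃ k ≤ K + ℓ + K, π' (n + k) ∈ T := by
  obtain ⟨m, hm1, hm2, hm3, -⟩ := exists_next_roundStart hK hσ hπ n
  obtain ⟨π₁, h1, t, ht, hT⟩ := hT (π m)
  have hmem : glue m π π₁ ∈ cyl π m := glue_mem_cyl h1.2.1
  have hstart : ∀ k < K, M.roundStart ℓ α K (glue m π π₁) (m + k) = m := by
    intro k hk
    induction k with
    | zero => rw [add_zero, roundStart_congr hmem, hm3]
    | succ k ih =>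
      rw [← add_assoc, roundStart, ih (by omega), if_neg]
      omega
  obtain ⟨π₂, h2, h3⟩ := exists_isOutcome_mem_cyl_of_stepOK (M := M)
    (σ := roundStrategy ℓ α K v₀ σ) (π := glue m π π₁) (n := m + t) fun j hj => by
      obtain hjm | hjm := lt_or_ge j m
      · exact stepOK_glue_of_lt h1.2.1 hjm (hπ.stepOK j)
      · obtain ⟨k, rfl⟩ := Nat.exists_eq_add_of_le hjm
        rw [stepOK_roundStrategy (hstart k (by omega)), playSuffix_glue, hmem m le_rfl]
        exact h1.stepOK k
  rw [hmem 0 m.zero_le, hπ.2.1] at h3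
  refine ⟨π₂, fun i hi => (h2 i (by omega)).trans (hmem i (by omega)), h3, m + t - n, by omega, ?_⟩
  rwa [show n + (m + t - n) = m + t by omega, h2 _ le_rfl, glue_add]

end Rounds

/-! ### Combinatorial bounds for the almost-sure winning region -/

/-- The vertices with a strategy that surely achieves `O` and from every history of which `T` can
be reached. -/
def recurrentRegion (M : MDP V) (O : Set (ℕ → V)) (T : Set V) : Set V :=
  {v | ∃ σ : M.Strategy, M.SureWinning σ v O ∧ ∀ π, M.IsOutcome σ v π → ∀ n,
    ∃ π' ∈ cyl π n, M.IsOutcome σ v π' ∧ ∃ k, π' (n + k) ∈ T}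

/-- The vertices with a strategy that surely achieves `O` and from every history of which `T` can
be reached within a uniformly bounded number of steps. -/
def boundedRecurrentRegion (M : MDP V) (O : Set (ℕ → V)) (T : Set V) : Set V :=
  {v | ∃ σ : M.Strategy, M.SureWinning σ v O ∧ ∃ N, ∀ π, M.IsOutcome σ v π → ∀ n,
    ∃ π' ∈ cyl π n, M.IsOutcome σ v π' ∧ ∃ k ≤ N, π' (n + k) ∈ T}

section Regions

variable [Finite V] [MeasurableSpace V] [DiscreteMeasurableSpace V]

theorem boundedRecurrentRegion_subset (M : MDP V) (O : Set (ℕ → V)) (T : Set V) :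
    M.boundedRecurrentRegion O T ⊆ M.sureAlmostSureRegion O (M.buchi T) := by
  rintro v ⟨σ, h1, N, h2⟩
  refine ⟨σ, h1, almostSureWinning_buchi N fun π hπ n => ?_⟩
  obtain ⟨π', h3, h4, h5⟩ := h2 π hπ n
  exact ⟨π', h4, h3, h5⟩

theorem sureAlmostSureRegion_subset (M : MDP V) (O : Set (ℕ → V)) (T : Set V) :
    M.sureAlmostSureRegion O (M.buchi T) ⊆ M.recurrentRegion O T := by
  rintro v ⟨σ, h1, h2⟩
  refine ⟨σ, h1, fun π hπ n => ?_⟩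
  obtain ⟨π', h3, h4, h5⟩ := exists_isOutcome_mem_cyl h2 hπ n
  obtain ⟨j, h6, h7⟩ := h3.2 n
  exact ⟨π', h5, h4, j - n, by rwa [Nat.add_sub_cancel' h6]⟩

theorem mem_boundedRecurrentRegion_of_eq_univ {M : MDP V} {ℓ : ℕ} {α : ℚ} {T : Set V}
    (h : M.surePositiveRegion (M.dirFWMP ℓ α) (M.reach T) = univ) (v : V) :
    v ∈ M.boundedRecurrentRegion (M.dirFWMP ℓ α) T := by
  have h' : ∀ u, u ∈ M.surePositiveRegion (M.dirFWMP ℓ α) (M.reach T) := fun u => h ▸ mem_univ u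
  simp only [mem_surePositiveRegion_reach_iff] at h'
  choose σ hσ π hπ t ht using h'
  obtain ⟨K, hK⟩ := (finite_range t).bddAbove
  -- `K` may be zero; `K + 1` makes the required round length positive.
  refine ⟨roundStrategy ℓ α (K + 1) v σ, sureWinning_roundStrategy (by omega) hσ v, _,
    fun π' hπ' n => exists_isOutcome_roundStrategy_mem (by omega) hσ (fun u => ?_) hπ' n⟩
  exact ⟨π u, hπ u, t u, (hK (mem_range_self u)).trans (Nat.le_succ K), ht u⟩

end Regions

/-! ### Strategies in subMDPs -/

section SubMDP

variable {M : MDP V} {S : Set V}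

theorem playPrefix_val (π : ℕ → S) (n : ℕ) :
    playPrefix (fun i => (π i : V)) n = (playPrefix π n).map Subtype.val := by
  simp only [playPrefix, List.map_map]
  rfl

theorem getLastD_playPrefix (π : ℕ → V) (n : ℕ) (v₀ : V) :
    (playPrefix π n).getLastD v₀ = π n := by
  rw [playPrefix, List.range_succ, List.map_append]
  simp

open Classical in
/-- A strategy of a subMDP as a strategy of the MDP. -/
noncomputable def liftStrategy (h : M.InducesSubMDP S) (v₀ : S) (σ : (M.subMDP S h).Strategy) :
    M.Strategy where
  move ρ :=
    if ρ.getLastD v₀ ∈ S then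
      σ.move (ρ.map fun u => if hu : u ∈ S then ⟨u, hu⟩ else v₀)
    else (M.exists_edge (ρ.getLastD v₀)).choose
  edge_move ρ v hv := by
    rw [List.getLastD_concat]
    split_ifs with hvS
    · rw [List.map_append, List.map_singleton, dif_pos hvS]
      exact σ.edge_move _ ⟨v, hvS⟩ hv
    · exact (M.exists_edge v).choose_spec

theorem stepOK_liftStrategy {h : M.InducesSubMDP S} {v₀ : S} {σ : (M.subMDP S h).Strategy}
    {π : ℕ → S} {j : ℕ} : M.StepOK (liftStrategy h v₀ σ) (fun i => (π i : V)) j ↔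
      (M.subMDP S h).StepOK σ π j := by
  have : (liftStrategy h v₀ σ).move (playPrefix (fun i => (π i : V)) j) =
      σ.move (playPrefix π j) := by
    simp only [liftStrategy]
    rw [if_pos (by rw [getLastD_playPrefix]; exact (π j).2), playPrefix_val, List.map_map]
    congr 2
    exact List.map_id'' (fun u => by simp) _
  unfold StepOK
  rw [this]
  exact and_congr Iff.rfl (imp_congr Iff.rfl Subtype.ext_iff.symm)

theorem isOutcome_liftStrategy {h : M.InducesSubMDP S} {v₀ v : S}
    {σ : (M.subMDP S h).Strategy} {π : ℕ → S} :
    M.IsOutcome (liftStrategy h v₀ σ) v (fun i => (π i : V)) ↔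
      (M.subMDP S h).IsOutcome σ v π := by
  rw [isOutcome_iff, isOutcome_iff]
  exact and_congr Subtype.ext_iff.symm (forall_congr' fun j => stepOK_liftStrategy)

theorem exists_eq_val_of_isOutcome_liftStrategy {h : M.InducesSubMDP S} {v₀ v : S}
    {σ : (M.subMDP S h).Strategy} {π : ℕ → V} (hπ : M.IsOutcome (liftStrategy h v₀ σ) v π) :
    ∃ π' : ℕ → S, π = fun i => (π' i : V) := by
  have hmem : ∀ j, π j ∈ S := by
    intro j
    induction j with
    | zero => rw [hπ.2.1]; exact v.2
    | succ j ih =>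
      by_cases hj : π j ∈ M.main
      · rw [hπ.2.2 j hj]
        simp only [liftStrategy]
        rw [if_pos (by rwa [getLastD_playPrefix])]
        exact Subtype.coe_prop _
      · exact h.2 _ ih hj _ (hπ.1 j)
  exact ⟨fun i => ⟨π i, hmem i⟩, rfl⟩

theorem val_mem_boundedRecurrentRegion {h : M.InducesSubMDP S} {ℓ : ℕ} {α : ℚ} {T : Set V} {v : S}
    (hv : v ∈ (M.subMDP S h).boundedRecurrentRegion ((M.subMDP S h).dirFWMP ℓ α)
      {u : S | (u : V) ∈ T}) : (v : V) ∈ M.boundedRecurrentRegion (M.dirFWMP ℓ α) T := by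
  obtain ⟨σ, h1, N, h2⟩ := hv
  refine ⟨liftStrategy h v σ, fun π hπ => ?_, N, fun π hπ n => ?_⟩ <;>
    obtain ⟨π, rfl⟩ := exists_eq_val_of_isOutcome_liftStrategy hπ <;>
    rw [isOutcome_liftStrategy] at hπ
  · exact h1 π hπ
  · obtain ⟨π', h3, h4, k, hk, h5⟩ := h2 π hπ n
    exact ⟨fun i => (π' i : V), fun i hi => congrArg Subtype.val (h3 i hi),
      isOutcome_liftStrategy.2 h4, k, hk, h5⟩

open Classical in
/-- The restriction of a strategy to a subMDP. -/
noncomputable def restrictStrategy (h : M.InducesSubMDP S) (v₀ : S) (σ : M.Strategy) :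
    (M.subMDP S h).Strategy where
  move ρ :=
    if hρ : σ.move (ρ.map Subtype.val) ∈ S then ⟨_, hρ⟩
    else ((M.subMDP S h).exists_edge (ρ.getLastD v₀)).choose
  edge_move ρ v hv := by
    split_ifs with hρ
    · have := σ.edge_move (ρ.map Subtype.val) v hv
      rwa [← List.map_singleton, ← List.map_append] at this
    · rw [List.getLastD_concat]
      exact ((M.subMDP S h).exists_edge v).choose_spec

theorem stepOK_restrictStrategy {h : M.InducesSubMDP S} {v₀ : S} {σ : M.Strategy}
    {π : ℕ → S} {j : ℕ}
    (hS : (π j : V) ∈ M.main → σ.move (playPrefix (fun i => (π i : V)) j) ∈ S) :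
    (M.subMDP S h).StepOK (restrictStrategy h v₀ σ) π j ↔
      M.StepOK σ (fun i => (π i : V)) j := by
  refine and_congr Iff.rfl (imp_congr_right fun hm => ?_)
  have hmem := hS hm
  rw [playPrefix_val] at hmem ⊢
  rw [Subtype.ext_iff]
  simp only [restrictStrategy]
  rw [dif_pos hmem]

/-- The fallback move of `restrictStrategy` is never used: a history consistent with `σ` extends to
an outcome of `σ`, which stays in `S`, so the next move of `σ` lies in `S`. -/
theorem isOutcome_restrictStrategy {h : M.InducesSubMDP S} {v₀ v : S} {σ : M.Strategy}
    (hσ : ∀ π, M.IsOutcome σ v π → ∀ i, π i ∈ S) {π : ℕ → S} :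
    (M.subMDP S h).IsOutcome (restrictStrategy h v₀ σ) v π ↔
      M.IsOutcome σ v (fun i => (π i : V)) := by
  constructor
  · intro hπ
    have hstep : ∀ n, ∀ j < n, M.StepOK σ (fun i => (π i : V)) j := by
      intro n
      induction n with
      | zero => exact fun j hj => absurd hj j.not_lt_zero
      | succ n ih =>
        intro j hj
        obtain hj | rfl := Nat.lt_succ_iff_lt_or_eq.1 hj
        · exact ih j hj
        refine (stepOK_restrictStrategy (v₀ := v₀) fun hm => ?_).1 (hπ.stepOK j)
        obtain ⟨π', h1, h2⟩ := exists_isOutcome_mem_cyl_of_stepOK ih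
        rw [hπ.2.1] at h2
        have h3 := h2.2.2 j (by rwa [h1 j le_rfl])
        rw [playPrefix_congr h1] at h3
        exact h3 ▸ hσ π' h2 (j + 1)
    exact isOutcome_iff.2 ⟨congrArg Subtype.val hπ.2.1, fun j => hstep (j + 1) j (by omega)⟩
  · intro hπ
    refine isOutcome_iff.2 ⟨Subtype.ext hπ.2.1, fun j => ?_⟩
    refine (stepOK_restrictStrategy fun hm => ?_).2 (hπ.stepOK j)
    exact hπ.2.2 j hm ▸ (π (j + 1)).2

theorem mem_recurrentRegion_subMDP {h : M.InducesSubMDP S} {ℓ : ℕ} {α : ℚ} {T : Set V} {v : S}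
    {σ : M.Strategy} (h1 : M.SureWinning σ v (M.dirFWMP ℓ α))
    (h2 : ∀ π, M.IsOutcome σ v π → ∀ n, ∃ π' ∈ cyl π n, M.IsOutcome σ v π' ∧ ∃ k, π' (n + k) ∈ T)
    (hσ : ∀ π, M.IsOutcome σ v π → ∀ i, π i ∈ S) :
    v ∈ (M.subMDP S h).recurrentRegion ((M.subMDP S h).dirFWMP ℓ α) {u : S | (u : V) ∈ T} := by
  refine ⟨restrictStrategy h v σ, fun π hπ => ?_, fun π hπ n => ?_⟩ <;>
    rw [isOutcome_restrictStrategy hσ] at hπ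
  · exact h1 _ hπ
  · obtain ⟨π', h3, h4, k, h5⟩ := h2 _ hπ n
    exact ⟨fun i => ⟨π' i, hσ π' h4 i⟩, fun i hi => Subtype.ext (h3 i hi),
      (isOutcome_restrictStrategy hσ).2 h4, k, h5⟩

end SubMDP

/-! ### Correctness of the algorithm -/

theorem mem_sureRegion_safe_of_isOutcome {M : MDP V} {σ : M.Strategy} {v : V} {W : Set V}
    (h : ∀ π, M.IsOutcome σ v π → ∀ i, π i ∈ W) {π : ℕ → V} (hπ : M.IsOutcome σ v π) (n : ℕ) :
    π n ∈ M.sureRegion (M.safe W) := by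
  refine ⟨residual σ (hist π n), fun π' hπ' => ⟨hπ'.1, fun i => ?_⟩⟩
  have := h _ (isOutcome_glue hπ.2.1 (fun j _ => hπ.stepOK j) hπ') (n + i)
  rwa [glue_add] at this

theorem recurrentRegion_subset_algo_subset {V : Type*} [Finite V] [MeasurableSpace V]
    [DiscreteMeasurableSpace V] (M : MDP V) (ℓ : ℕ) (α : ℚ) (T : Set V) :
    M.recurrentRegion (M.dirFWMP ℓ α) T ⊆ M.sureDirFWMPASBuchiAlgo ℓ α T ∧
      M.sureDirFWMPASBuchiAlgo ℓ α T ⊆ M.boundedRecurrentRegion (M.dirFWMP ℓ α) T := by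
  rw [sureDirFWMPASBuchiAlgo]
  split_ifs with hW
  · exact ⟨subset_univ _, fun v _ => mem_boundedRecurrentRegion_of_eq_univ hW v⟩
  obtain ⟨ih₁, ih₂⟩ := recurrentRegion_subset_algo_subset
    (M.subMDP _ (M.inducesSubMDP_sureRegion_safe
      (M.surePositiveRegion (M.dirFWMP ℓ α) (M.reach T)))) ℓ α {v | (v : V) ∈ T}
  constructor
  · rintro v ⟨σ, h1, h2⟩
    -- After any history, the residual strategy still surely achieves the window objective and has
    -- an outcome visiting `T`, so the current vertex lies in `W`.
    have hsafe : ∀ π, M.IsOutcome σ v π → ∀ i,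
        π i ∈ M.surePositiveRegion (M.dirFWMP ℓ α) (M.reach T) := by
      intro π hπ i
      obtain ⟨π', h3, h4, k, h5⟩ := h2 π hπ i
      rw [← h3 i le_rfl]
      exact mem_surePositiveRegion_reach_iff.2
        ⟨_, h1.residual h4 i, _, h4.playSuffix i, k, h5⟩
    have hS : ∀ π, M.IsOutcome σ v π → ∀ i, π i ∈ _ := fun π hπ i =>
      mem_sureRegion_safe_of_isOutcome hsafe hπ i
    obtain ⟨π, hπ⟩ := M.exists_isOutcome σ v
    have hv := hS π hπ 0
    rw [hπ.2.1] at hv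
    exact ⟨⟨v, hv⟩, ih₁ (mem_recurrentRegion_subMDP h1 h2 hS), rfl⟩
  · rintro _ ⟨v, hv, rfl⟩
    exact val_mem_boundedRecurrentRegion (ih₂ hv)
termination_by Nat.card V
decreasing_by
  obtain ⟨x, hx⟩ := (Set.ne_univ_iff_exists_notMem _).1 hW
  exact Finite.card_subtype_lt fun h => hx (M.sureRegion_safe_subset _ h)

end MDP

theorem mainTheorem7 {V : Type*} [Finite V] [MeasurableSpace V] [DiscreteMeasurableSpace V]
    (M : MDP V) (ℓ : ℕ) (hℓ : 1 ≤ ℓ) (α : ℚ) (T : Set V) :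
    M.sureDirFWMPASBuchiAlgo ℓ α T =
        M.sureAlmostSureRegion (M.dirFWMP ℓ α) (M.buchi T) ∧
      M.surePositiveRegion (M.dirFWMP ℓ α) (M.reach T) ⊆
        M.surePositiveRegion (M.dirFWMP ℓ α) (M.reachWithin (Nat.card V * ℓ) T) := by
  obtain ⟨h₁, h₂⟩ := MDP.recurrentRegion_subset_algo_subset M ℓ α T
  exact ⟨Set.Subset.antisymm (h₂.trans (M.boundedRecurrentRegion_subset _ _))
    ((M.sureAlmostSureRegion_subset _ _).trans h₁),
    M.surePositiveRegion_reach_subset_reachWithin ℓ α T⟩
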